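/- For $n\ge 0$ let $A'_n=\sum_{k=0}^{n}\binom{n}{k}^2\binom{n+k}{k}$ be the second Apéry numbers, and let the Bernoulli numbers $B_n$ be defined by $\frac{x}{e^x-1}=\sum_{n=0}^\infty B_n\frac{x^n}{n!}$. For every prime $p\ge 7$, $$A'_{p-1}\equiv 1+p^3\left(\frac{10}{3}B_{p-3}-\frac{5}{4}B_{2p-4}\right)+\frac{5}{18}p^4B_{p-3}\pmod{p^5},$$ where, for rational numbers $x,y$, $x\equiv y\pmod{p^5}$ means that $x-y=p^5z$ for some rational number $z$ whose denominator is not divisible by $p$. -/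

import Mathlib

/-- The second Apéry numbers `A'ₙ = ∑_{k=0}^{n} C(n,k)² C(n+k,k)`. -/
def aperyTwo (n : ℕ) : ℕ :=
  ∑ k ∈ Finset.range (n + 1), n.choose k ^ 2 * (n + k).choose k

/-- Congruence of rational numbers modulo `m`: the difference is `m` times a rational number
whose denominator (in lowest terms) is coprime to `m`. -/
def RatModEq (m : ℕ) (x y : ℚ) : Prop :=
  ∃ z : ℚ, z.den.Coprime m ∧ x - y = (m : ℚ) * z

/-! Write H(a, b, …) for the sum of k₁^(-a) k₂^(-b) ⋯ over p > k₁ > k₂ > ⋯ > 0, taken in `ℤ_[p]`. In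
the alternating form of A'_(p-1) every term with k ≥ 1 carries p². Expanding the remaining products
of factors 1 ± p/j up to p² leaves H(2), H(2,1), H(3) and sums of weight four
(`pow_five_dvd_aperyTwo_sub`). Evaluating ∑ (-1)^k C(p-1,k)/k² in two ways removes H(2,1); the
reflection k ↦ p - k and a duality for binomial transforms dispose of the rest. What remains is
A'_(p-1) ≡ 1 + (5/2) p² H(2) mod p⁵ (`pow_five_dvd_two_mul_aperyTwo_sub`).

So H(2) is needed mod p³. By Euler's theorem it is a power sum of exponent φ(p³) - 2, and a Voronoi
congruence expresses it through the power sums of exponents p - 3 and 2p - 4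
(`power_sum_relations`). Faulhaber's formula and von Staudt–Clausen identify these with p B_(p-3)
and p B_(2p-4) mod p³. -/

open Finset

/-! ### Alternating form of the Apéry numbers -/

/-- The binomial sums `∑ (-1)^(m-l) C(m,l) C(N+l, m+i)` are iterated differences of `C(·, m+i)`. -/
theorem sum_neg_one_pow_mul_choose_mul_choose (m i N : ℕ) :
    ∑ l ∈ range (m + 1), (-1 : ℤ) ^ (m - l) * m.choose l * (N + l).choose (m + i) =
      N.choose i := by
  have h := congrFun (fwdDiff_iter_choose i m) N
  rw [fwdDiff_iter_eq_sum_shift] at h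
  simpa using h

theorem add_choose_eq_sum_choose_mul_choose (n k : ℕ) :
    (n + k).choose k = ∑ i ∈ range (n + 1), n.choose i * k.choose i := by
  rw [← Nat.choose_symm_add, add_comm n k, Nat.add_choose_eq,
    Finset.Nat.sum_antidiagonal_eq_sum_range_succ (fun a b => k.choose a * n.choose b)]
  refine sum_congr rfl fun i hi => ?_
  rw [Nat.choose_symm (Nat.lt_succ_iff.mp (mem_range.mp hi)), mul_comm]

/-- The second Apéry numbers as an alternating sum. -/
theorem aperyTwo_eq_alternating_sum (n : ℕ) :
    (aperyTwo n : ℤ) =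
      ∑ k ∈ range (n + 1), (-1) ^ (n - k) * n.choose k * ((n + k).choose k : ℤ) ^ 2 := by
  -- One factor C(n+k,k) is expanded by Vandermonde. Since C(n,k) C(k,i) = C(n,i) C(n-i,k-i), the
  -- sum over k is then an iterated difference of order n - i.
  have key : ∀ i ∈ range (n + 1), ∑ k ∈ range (n + 1),
      (-1 : ℤ) ^ (n - k) * n.choose k * (n + k).choose k * k.choose i =
        n.choose i * (n + i).choose i := by
    intro i hi
    obtain ⟨m, rfl⟩ := Nat.exists_eq_add_of_le' (Nat.lt_succ_iff.mp (mem_range.mp hi))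
    have hsplit : m + i + 1 = i + (m + 1) := by ring
    rw [hsplit, sum_range_add, sum_eq_zero, zero_add,
      ← sum_neg_one_pow_mul_choose_mul_choose m i (m + i + i), mul_sum]
    · refine sum_congr rfl fun l hl => ?_
      have hl' : l ≤ m := Nat.lt_succ_iff.mp (mem_range.mp hl)
      have h1 := Nat.choose_mul (n := m + i) (k := i + l) (s := i) (by lia)
      rw [show m + i - i = m by lia, show i + l - i = l by lia] at h1
      have h2 : ((m + i).choose (i + l) : ℤ) * (i + l).choose i =
          (m + i).choose i * m.choose l := by
        exact_mod_cast h1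
      rw [show m + i - (i + l) = m - l by lia, ← Nat.choose_symm_add (a := m + i) (b := i + l),
        show m + i + (i + l) = m + i + i + l by ring]
      linear_combination ((-1 : ℤ) ^ (m - l) * (m + i + i + l).choose (m + i)) * h2
    · intro k hk
      rw [Nat.choose_eq_zero_of_lt (mem_range.mp hk)]
      simp
  have hk : ∀ k ∈ range (n + 1),
      (-1 : ℤ) ^ (n - k) * n.choose k * ((n + k).choose k : ℤ) ^ 2 =
        ∑ i ∈ range (n + 1), n.choose i *
          ((-1 : ℤ) ^ (n - k) * n.choose k * (n + k).choose k * k.choose i) := by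
    intro k _
    rw [sq, ← mul_assoc]
    nth_rewrite 2 [add_choose_eq_sum_choose_mul_choose n k]
    push_cast
    rw [mul_sum]
    exact sum_congr rfl fun i _ => by ring
  rw [sum_congr rfl hk, sum_comm, aperyTwo]
  push_cast
  refine sum_congr rfl fun i hi => ?_
  rw [← mul_sum, key i hi]
  ring

/-! ### Binomial transforms and multiple harmonic sums -/

section BinomialTransform

variable {R : Type*} [CommRing R]

/-- The binomial transform `m ↦ ∑_{k=1}^m (-1)^k C(m,k) f(k)`, where `f k` stands for the value at
`k + 1`. -/
def binomTransform (f : ℕ → R) (m : ℕ) : R :=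
  ∑ k ∈ range m, (-1) ^ (k + 1) * (m.choose (k + 1) : R) * f k

/-- Multiple harmonic sums `∑_{n > k₁ > k₂ > ⋯} x(k₁)^a₁ x(k₂)^a₂ ⋯`. -/
def mhs (x : ℕ → R) : List ℕ → ℕ → R
  | [], _ => 1
  | a :: s, n => ∑ k ∈ range n, x k ^ a * mhs x s k

theorem mhs_nil (x : ℕ → R) (n : ℕ) : mhs x [] n = 1 := rfl

theorem mhs_cons (x : ℕ → R) (a : ℕ) (s : List ℕ) (n : ℕ) :
    mhs x (a :: s) n = ∑ k ∈ range n, x k ^ a * mhs x s k := rfl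

theorem mhs_succ (x : ℕ → R) (a : ℕ) (s : List ℕ) (n : ℕ) :
    mhs x (a :: s) (n + 1) = mhs x (a :: s) n + x n ^ a * mhs x s n := by
  simp [mhs, sum_range_succ]

theorem map_mhs {S : Type*} [CommRing S] (φ : R →+* S) (x : ℕ → R) (s : List ℕ) (n : ℕ) :
    φ (mhs x s n) = mhs (fun k => φ (x k)) s n := by
  induction s generalizing n with
  | nil => simp [mhs]
  | cons a s ih => simp [mhs, ih]

theorem mhs_mul_mhs (x : ℕ → R) (a b n : ℕ) :
    mhs x [a] n * mhs x [b] n = mhs x [a, b] n + mhs x [b, a] n + mhs x [a + b] n := by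
  induction n with
  | zero => simp [mhs]
  | succ n ih =>
    simp only [mhs_succ] at ih ⊢
    simp only [mhs] at ih ⊢
    linear_combination ih

variable {x : ℕ → R} {N : ℕ}

/-- Absorption identity. Inverses enter as a sequence `x` with `x k` = 1/(k+1), so that the same
identities serve `ℤ_[p]` and `ZMod p`. -/
theorem choose_mul_inv_eq (hx : ∀ k < N, ((k : R) + 1) * x k = 1) {m k : ℕ} (hm : m < N)
    (hk : k ≤ m) : (m.choose k : R) * x k = x m * (m + 1).choose (k + 1) := by
  have h : ((m : R) + 1) * m.choose k = (m + 1).choose (k + 1) * ((k : R) + 1) := by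
    exact_mod_cast congrArg (Nat.cast (R := R)) (Nat.add_one_mul_choose_eq m k)
  linear_combination (-(m.choose k : R) * x k) * hx m hm + x m * x k * h +
    x m * ((m + 1).choose (k + 1) : R) * hx k (hk.trans_lt hm)

/-- By Pascal and absorption, raising m by one adds exactly `x m` times the transform of `f` at m +
1. -/
theorem binomTransform_mul_inv (hx : ∀ k < N, ((k : R) + 1) * x k = 1) (f : ℕ → R) {m : ℕ}
    (hm : m ≤ N) : binomTransform (fun k => f k * x k) m =
      ∑ l ∈ range m, x l * binomTransform f (l + 1) := by
  induction m with
  | zero => simp [binomTransform]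
  | succ m ih =>
    rw [sum_range_succ, ← ih (by lia)]
    simp only [binomTransform]
    have : ∑ k ∈ range m, (-1) ^ (k + 1) * (m.choose (k + 1) : R) * (f k * x k) =
        ∑ k ∈ range (m + 1), (-1) ^ (k + 1) * (m.choose (k + 1) : R) * (f k * x k) := by
      simp [sum_range_succ]
    rw [this, mul_sum, ← sum_add_distrib]
    refine sum_congr rfl fun k hk => ?_
    have h := choose_mul_inv_eq hx (show m < N by lia) (Nat.lt_succ_iff.mp (mem_range.mp hk))
    have hc : ((m + 1).choose (k + 1) : R) = m.choose k + m.choose (k + 1) := by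
      rw [Nat.choose_succ_succ']; push_cast; ring
    linear_combination (-1) ^ (k + 1) * f k * h + (-1) ^ (k + 1) * f k * x k * hc

/-- Summation by parts: Pascal's rule makes the difference of the two sides telescope, and both
boundary terms vanish. -/
theorem binomTransform_sum_range (h : ℕ → R) (m : ℕ) :
    binomTransform (fun k => ∑ j ∈ range (k + 1), h j) (m + 1) =
      ∑ j ∈ range (m + 1), (-1) ^ (j + 1) * (m.choose j : R) * h j := by
  have h0 := Finset.sum_range_sub
    (fun k => (-1 : R) ^ k * (m.choose k : R) * ∑ j ∈ range k, h j) (m + 1)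
  simp only [Nat.choose_succ_self, range_zero, sum_empty, Nat.cast_zero, mul_zero, zero_mul,
    sub_zero] at h0
  rw [binomTransform, ← sub_eq_zero, ← sum_sub_distrib, ← h0]
  refine sum_congr rfl fun k _ => ?_
  rw [Nat.choose_succ_succ', Nat.cast_add, sum_range_succ]
  ring

theorem binomTransform_one (m : ℕ) : binomTransform (fun _ => (1 : R)) (m + 1) = -1 := by
  have h := binomTransform_sum_range (R := R) (fun j => if j = 0 then 1 else 0) m
  simpa using h

theorem binomTransform_sum_mul_inv (hx : ∀ k < N, ((k : R) + 1) * x k = 1) (g : ℕ → R) {m : ℕ}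
    (hm : m < N) : binomTransform (fun k => ∑ j ∈ range (k + 1), g j * x j) (m + 1) =
      x m * binomTransform g (m + 1) := by
  rw [binomTransform_sum_range, binomTransform, mul_sum]
  refine sum_congr rfl fun k hk => ?_
  linear_combination (-1) ^ (k + 1) * g k *
    choose_mul_inv_eq hx hm (Nat.lt_succ_iff.mp (mem_range.mp hk))

theorem binomTransform_inv_sq (hx : ∀ k < N, ((k : R) + 1) * x k = 1) :
    binomTransform (fun k => x k ^ 2) N = -(mhs x [1, 1] N + mhs x [2] N) := by
  have h1 : ∀ l ∈ range N, x l * binomTransform (fun k => 1 * x k) (l + 1) =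
      -(x l * mhs x [1] l + x l ^ 2) := by
    intro l hl
    rw [binomTransform_mul_inv hx _ (Nat.succ_le_of_lt (mem_range.mp hl))]
    simp only [binomTransform_one, sum_range_succ, mhs]
    simp only [mul_neg, mul_one, sum_neg_distrib, pow_one]
    ring
  have h2 := binomTransform_mul_inv hx (fun k => 1 * x k) le_rfl
  rw [sum_congr rfl h1] at h2
  simp only [one_mul, ← sq] at h2
  rw [h2]
  simp [mhs, sum_add_distrib]

/-- The weak double sum arises from the constant 1 by dividing by the index and taking partial sums,
twice. Its transform is therefore `-x m ^ 2`, and each of the two further factors `x k` becomes an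
outer summation. -/
theorem binomTransform_duality (hx : ∀ k < N, ((k : R) + 1) * x k = 1) :
    binomTransform (fun k => (mhs x [1, 1] (k + 1) + mhs x [2] (k + 1)) * x k ^ 2) N =
      -(mhs x [1, 3] N + mhs x [4] N) := by
  have h0 : ∀ k, mhs x [1, 1] (k + 1) + mhs x [2] (k + 1) =
      ∑ j ∈ range (k + 1), (∑ i ∈ range (j + 1), 1 * x i) * x j := by
    intro k
    simp only [mhs, ← sum_add_distrib]
    refine sum_congr rfl fun j _ => ?_
    rw [sum_range_succ]
    simp
    ring
  have h1 : ∀ m < N, binomTransform (fun k => mhs x [1, 1] (k + 1) + mhs x [2] (k + 1)) (m + 1) =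
      -x m ^ 2 := by
    intro m hm
    simp only [h0]
    rw [binomTransform_sum_mul_inv hx _ hm, binomTransform_sum_mul_inv hx _ hm, binomTransform_one]
    ring
  have h2 : ∀ m ≤ N, binomTransform
      (fun k => (mhs x [1, 1] (k + 1) + mhs x [2] (k + 1)) * x k) m = -mhs x [3] m := by
    intro m hm
    rw [binomTransform_mul_inv hx _ hm]
    rw [sum_congr rfl fun l hl => by rw [h1 l ((mem_range.mp hl).trans_le hm)], mhs,
      ← sum_neg_distrib]
    refine sum_congr rfl fun l _ => ?_
    simp only [mhs]
    ring
  have h3 := binomTransform_mul_inv hx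
    (fun k => (mhs x [1, 1] (k + 1) + mhs x [2] (k + 1)) * x k) le_rfl
  simp only [mul_assoc, ← sq] at h3
  rw [h3, mhs, mhs, ← sum_add_distrib, ← sum_neg_distrib]
  refine sum_congr rfl fun l hl => ?_
  have := h2 (l + 1) (Nat.succ_le_of_lt (mem_range.mp hl))
  rw [this, mhs_succ]
  simp only [mhs]
  ring

end BinomialTransform

/-! ### Expansions in powers of t = n + 1 -/

section Expansion

variable {R : Type*} [CommRing R]

theorem pow_three_dvd_prod_one_add_mul_sub (x : ℕ → R) (t : R) (k : ℕ) :
    t ^ 3 ∣ ∏ j ∈ range k, (1 + t * x j) - (1 + t * mhs x [1] k + t ^ 2 * mhs x [1, 1] k) := by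
  induction k with
  | zero => simp [mhs]
  | succ k ih =>
    obtain ⟨c, hc⟩ := ih
    rw [prod_range_succ, mhs_succ, mhs_succ, sub_eq_iff_eq_add.mp hc]
    refine ⟨c * (1 + t * x k) + x k * mhs x [1, 1] k, ?_⟩
    simp only [mhs]
    ring

variable {x : ℕ → R} {n : ℕ}

theorem neg_one_pow_mul_choose_eq_prod (hx : ∀ k < n, ((k : R) + 1) * x k = 1) {k : ℕ}
    (hk : k ≤ n) :
    (-1) ^ k * (n.choose k : R) = ∏ j ∈ range k, (1 - ((n : R) + 1) * x j) := by
  induction k with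
  | zero => simp
  | succ k ih =>
    have h : (n.choose (k + 1) : R) * ((k : R) + 1) = n.choose k * ((n : R) - k) := by
      have := congrArg (Nat.cast (R := R)) (Nat.choose_succ_right_eq n k)
      push_cast [Nat.cast_sub (show k ≤ n by lia)] at this
      exact this
    rw [prod_range_succ, ← ih (by lia)]
    linear_combination (-(-1) ^ (k + 1) * (n.choose (k + 1) : R) + (-1) ^ k * (n.choose k : R)) *
      hx k hk + (-1) ^ (k + 1) * x k * h

theorem add_choose_eq_prod (hx : ∀ k < n, ((k : R) + 1) * x k = 1) (m : ℕ) {k : ℕ} (hk : k ≤ n) :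
    ((m + k).choose k : R) = ∏ j ∈ range k, (1 + (m : R) * x j) := by
  induction k with
  | zero => simp
  | succ k ih =>
    have h : (((m : R) + k) + 1) * (m + k).choose k =
        (m + (k + 1)).choose (k + 1) * ((k : R) + 1) := by
      exact_mod_cast congrArg (Nat.cast (R := R)) (Nat.add_one_mul_choose_eq (m + k) k)
    rw [prod_range_succ, ← ih (by lia)]
    linear_combination (-((m + (k + 1)).choose (k + 1) : R) + ((m + k).choose k : R)) * hx k hk
      - x k * h

/-- The isolated factor `m`, later n + 1 = p, is squared in the Apéry sum, so the products are
needed only mod p³. -/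
theorem add_choose_succ_eq_prod (hx : ∀ k < n, ((k : R) + 1) * x k = 1) (m : ℕ) {k : ℕ}
    (hk : k < n) :
    ((m + k).choose (k + 1) : R) = m * x k * ∏ j ∈ range k, (1 + (m : R) * x j) := by
  have h : ((m + k).choose (k + 1) : R) * ((k : R) + 1) = (m + k).choose k * m := by
    have := congrArg (Nat.cast (R := R)) (Nat.choose_succ_right_eq (m + k) k)
    rw [Nat.add_sub_cancel] at this
    exact_mod_cast this
  rw [← add_choose_eq_prod hx m hk.le]
  linear_combination (-((m + k).choose (k + 1) : R)) * hx k hk + x k * h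

/-- `aperyTwo n` as a sum of products over the inverses `x k` of `k + 1`, for even `n`. -/
theorem aperyTwo_eq_one_add_sum_prod (hx : ∀ k < n, ((k : R) + 1) * x k = 1) (hn : Even n) :
    (aperyTwo n : R) = 1 + ((n : R) + 1) ^ 2 * ∑ k ∈ range n, x k ^ 2 *
      ((1 - ((n : R) + 1) * x k) * ∏ j ∈ range k, (1 - ((n : R) + 1) * x j)) *
        (∏ j ∈ range k, (1 + ((n : R) + 1) * x j)) ^ 2 := by
  have h := congrArg (Int.cast (R := R)) (aperyTwo_eq_alternating_sum n)
  push_cast at h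
  rw [h, sum_range_succ', mul_sum, add_comm]
  congr 1
  · simp [hn.neg_one_pow]
  · refine sum_congr rfl fun k hk => ?_
    have hk' : k + 1 ≤ n := Nat.succ_le_of_lt (mem_range.mp hk)
    have h1 : (-1 : R) ^ (n - (k + 1)) = (-1) ^ (k + 1) := by
      have h2 : (-1 : R) ^ (n - (k + 1)) * (-1) ^ (k + 1) = 1 := by
        rw [← pow_add, Nat.sub_add_cancel hk', hn.neg_one_pow]
      have h3 : (-1 : R) ^ (k + 1) * (-1) ^ (k + 1) = 1 := by
        rw [← mul_pow]; simp
      linear_combination (-1 : R) ^ (k + 1) * h2 - (-1 : R) ^ (n - (k + 1)) * h3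
    have h4 := add_choose_succ_eq_prod hx (n + 1) hk'
    rw [h1, neg_one_pow_mul_choose_eq_prod hx hk', prod_range_succ,
      show n + (k + 1) = n + 1 + k by ring, h4]
    push_cast
    ring

theorem pow_five_dvd_aperyTwo_sub (hx : ∀ k < n, ((k : R) + 1) * x k = 1) (hn : Even n) {t : R}
    (ht : t = (n : R) + 1) :
    t ^ 5 ∣ (aperyTwo n : R) - 1 - t ^ 2 * (mhs x [2] n + t * (mhs x [2, 1] n - mhs x [3] n) +
      t ^ 2 * (mhs x [2, 1, 1] n - mhs x [2, 2] n - mhs x [3, 1] n)) := by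
  rw [aperyTwo_eq_one_add_sum_prod hx hn, ← ht, add_sub_cancel_left, ← mul_sub,
    show t ^ 5 = t ^ 2 * t ^ 3 by ring]
  refine mul_dvd_mul_left _ ?_
  simp only [mhs_cons x _ _ n, mhs_nil, mul_sum, ← sum_sub_distrib, ← sum_add_distrib]
  refine dvd_sum fun k _ => ?_
  obtain ⟨a, ha⟩ := pow_three_dvd_prod_one_add_mul_sub x t k
  obtain ⟨b, hb⟩ := pow_three_dvd_prod_one_add_mul_sub x (-t) k
  have hsq := mhs_mul_mhs x 1 1 k
  simp only [neg_mul, ← sub_eq_add_neg] at hb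
  rw [sub_eq_iff_eq_add.mp ha, sub_eq_iff_eq_add.mp hb]
  generalize mhs x [1] k = h at *
  norm_num at hsq
  rw [show mhs x [2] k = h * h - 2 * mhs x [1, 1] k by linear_combination -hsq]
  generalize mhs x [1, 1] k = e at *
  generalize x k = z
  -- Modulo t³ the product (1 - th + t²e)(1 + th + t²e)² is 1 + th + t²(3e - h²), and 3e - h² is e
  -- minus the sum of squares. The witness collects the higher terms and the truncation errors `a`,
  -- `b`.
  refine ⟨z ^ 2 * (2 * h * e - h ^ 3 + t * (3 * e ^ 2 - h ^ 2 * e) + t ^ 2 * h * e ^ 2 +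
    t ^ 3 * e ^ 3 - z * (3 * e - h ^ 2) - t * z * (2 * h * e - h ^ 3 +
      t * (3 * e ^ 2 - h ^ 2 * e) + t ^ 2 * h * e ^ 2 + t ^ 3 * e ^ 3) +
    (1 - t * z) * (-b * (t ^ 3 * a + (1 + t * h + t ^ 2 * e)) ^ 2 +
      (1 - t * h + t ^ 2 * e) * a * (t ^ 3 * a + 2 * (1 + t * h + t ^ 2 * e)))), ?_⟩
  ring

/-- Expands the binomials in `binomTransform_inv_sq`; used to trade t H(2,1) for H(1,1) + 2 H(2). -/
theorem pow_three_dvd_inv_sq_relation (hx : ∀ k < n, ((k : R) + 1) * x k = 1) {t : R}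
    (ht : t = (n : R) + 1) :
    t ^ 3 ∣ mhs x [1, 1] n + mhs x [2] n + (mhs x [2] n - t * (mhs x [3] n + mhs x [2, 1] n) +
      t ^ 2 * (mhs x [3, 1] n + mhs x [2, 1, 1] n)) := by
  have h := binomTransform_inv_sq hx
  rw [← neg_eq_iff_eq_neg] at h
  rw [← h, binomTransform, neg_add_eq_sub, ← dvd_neg, neg_sub]
  simp only [mhs_cons x _ _ n, mhs_nil, mul_sum, ← sum_sub_distrib, ← sum_add_distrib]
  refine dvd_sum fun k hk => ?_
  rw [neg_one_pow_mul_choose_eq_prod hx (Nat.succ_le_of_lt (mem_range.mp hk)), prod_range_succ,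
    ← ht]
  obtain ⟨b, hb⟩ := pow_three_dvd_prod_one_add_mul_sub x (-t) k
  simp only [neg_mul, ← sub_eq_add_neg] at hb
  rw [sub_eq_iff_eq_add.mp hb]
  generalize mhs x [1] k = h
  generalize mhs x [1, 1] k = e
  refine ⟨x k ^ 2 * (-b * (1 - t * x k) - x k * e), ?_⟩
  ring

end Expansion

/-! ### Harmonic sums modulo p -/

section ZMod

variable {p : ℕ} [Fact p.Prime] {y : ℕ → ZMod p}

theorem sum_inv_pow_eq_zero (hy : ∀ k < p - 1, ((k : ZMod p) + 1) * y k = 1) {a : ℕ}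
    (ha : ¬ (p - 1) ∣ a) : mhs y [a] (p - 1) = 0 := by
  have hbij : mhs y [a] (p - 1) = ∑ u : (ZMod p)ˣ, (u : ZMod p) ^ a := by
    simp only [mhs, mul_one]
    have hp := (Fact.out : p.Prime).two_le
    have hlt : ∀ u : (ZMod p)ˣ, 0 < (u : ZMod p).val := fun u =>
      Nat.pos_of_ne_zero fun h => u.ne_zero ((ZMod.val_eq_zero _).mp h)
    have hval : ∀ u : (ZMod p)ˣ, (((u : ZMod p).val - 1 : ℕ) : ZMod p) + 1 = u := fun u => by
      rw [Nat.cast_sub (hlt u)]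
      simp
    have hmem : ∀ u : (ZMod p)ˣ, (u : ZMod p).val - 1 < p - 1 := fun u => by
      have := ZMod.val_lt (u : ZMod p)
      have := hlt u
      lia
    refine Finset.sum_bij' (i := fun k hk => Units.mk (y k) ((k : ZMod p) + 1)
        (by rw [mul_comm]; exact hy k (mem_range.mp hk)) (hy k (mem_range.mp hk)))
      (j := fun u _ => ((u⁻¹ : (ZMod p)ˣ) : ZMod p).val - 1) (fun _ _ => mem_univ _)
      (fun u _ => mem_range.mpr (hmem _)) ?_ ?_ (fun _ _ => rfl)
    · intro k hk
      have hk' := mem_range.mp hk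
      have : ((k : ZMod p) + 1).val = k + 1 := by
        rw [← Nat.cast_succ, ZMod.val_cast_of_lt (by lia)]
      simp [this]
    · intro u _
      ext
      have h := hy _ (hmem u⁻¹)
      rw [hval] at h
      calc _ = (u : ZMod p) * (((u⁻¹ : (ZMod p)ˣ) : ZMod p) * y _) := by
              rw [← mul_assoc, Units.mul_inv, one_mul]
        _ = u := by rw [h, mul_one]
  rw [hbij, FiniteField.sum_pow_units, ZMod.card, if_neg ha]

theorem inv_reflect (hy : ∀ k < p - 1, ((k : ZMod p) + 1) * y k = 1) {k : ℕ} (hk : k < p - 1) :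
    y (p - 1 - 1 - k) = -y k := by
  have h1 := hy (p - 1 - 1 - k) (by lia)
  have h2 : ((p - 1 - 1 - k : ℕ) : ZMod p) + 1 = -((k : ZMod p) + 1) := by
    have : (((p - 1 - 1 - k) + 1 + (k + 1) : ℕ) : ZMod p) = 0 := by
      rw [show (p - 1 - 1 - k) + 1 + (k + 1) = p by lia, ZMod.natCast_self]
    push_cast at this
    linear_combination this
  rw [h2] at h1
  linear_combination (-y k) * h1 - y (p - 1 - 1 - k) * hy k hk

theorem mhs_singleton_sub (hy : ∀ k < p - 1, ((k : ZMod p) + 1) * y k = 1) {b : ℕ}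
    (hb : ¬ (p - 1) ∣ b) {k : ℕ} (hk : k ≤ p - 1) :
    mhs y [b] (p - 1 - k) = -(-1) ^ b * mhs y [b] k := by
  induction k with
  | zero => rw [Nat.sub_zero, sum_inv_pow_eq_zero hy hb]; simp [mhs]
  | succ k ih =>
    have h1 := ih (by lia)
    rw [show p - 1 - k = p - 1 - (k + 1) + 1 by lia, mhs_succ, mhs_nil,
      show p - 1 - (k + 1) = p - 1 - 1 - k by lia, inv_reflect hy (by lia), neg_pow] at h1
    rw [mhs_succ, mhs_nil, show p - 1 - (k + 1) = p - 1 - 1 - k by lia]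
    linear_combination h1

/-- In even weight the reflection k ↦ p - k gives H(a,b) = -H(a,b) - H(a+b), where H(a+b) = 0 and p
is odd. -/
theorem mhs_pair_eq_zero (hp2 : p ≠ 2) (hy : ∀ k < p - 1, ((k : ZMod p) + 1) * y k = 1)
    {a b : ℕ} (hab : Even (a + b)) (hb : ¬ (p - 1) ∣ b) (hs : ¬ (p - 1) ∣ a + b) :
    mhs y [a, b] (p - 1) = 0 := by
  have h := Finset.sum_range_reflect (fun k => y k ^ a * mhs y [b] k) (p - 1)
  have h1 : ∀ k ∈ range (p - 1), y (p - 1 - 1 - k) ^ a * mhs y [b] (p - 1 - 1 - k) =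
      -(y k ^ a * mhs y [b] k + y k ^ (a + b)) := by
    intro k hk
    have hk' := mem_range.mp hk
    rw [inv_reflect hy hk', show p - 1 - 1 - k = p - 1 - (k + 1) by lia,
      mhs_singleton_sub hy hb (by lia), mhs_succ, mhs_nil, neg_pow]
    linear_combination (-(y k ^ a * mhs y [b] k + y k ^ (a + b))) * hab.neg_one_pow (α := ZMod p)
  rw [sum_congr rfl h1, sum_neg_distrib, sum_add_distrib] at h
  have h2 := sum_inv_pow_eq_zero hy hs
  simp only [mhs_cons y _ _ (p - 1), mhs_nil, mul_one] at h2 ⊢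
  rw [h2, add_zero] at h
  exact ZMod.neg_eq_self_iff _ |>.mp h |>.resolve_right (by
    have := (Fact.out : p.Prime).eq_one_or_self_of_dvd 2
    intro h
    have := this ⟨_, h.symm⟩
    lia)

/-- In `ZMod p` each (-1)^k C(p-1,k) is 1, so the duality reads H(2,1,1) + H(3,1) + H(2,2) + H(4) =
-H(1,3) - H(4), where every other sum vanishes. -/
theorem mhs_two_one_one_eq_zero (hp7 : 7 ≤ p) (hy : ∀ k < p - 1, ((k : ZMod p) + 1) * y k = 1) :
    mhs y [2, 1, 1] (p - 1) = 0 := by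
  have hnd : ∀ a, 0 < a → a < 6 → ¬ (p - 1) ∣ a := fun a h0 h h' => by
    have := Nat.le_of_dvd h0 h'
    lia
  have h := binomTransform_duality hy
  have h4 := sum_inv_pow_eq_zero hy (hnd 4 (by lia) (by lia))
  have h13 := mhs_pair_eq_zero (a := 1) (b := 3) (by lia) hy (by decide)
    (hnd _ (by lia) (by lia)) (hnd _ (by lia) (by lia))
  have h31 := mhs_pair_eq_zero (a := 3) (b := 1) (by lia) hy (by decide)
    (hnd _ (by lia) (by lia)) (hnd _ (by lia) (by lia))
  have h22 := mhs_pair_eq_zero (a := 2) (b := 2) (by lia) hy (by decide)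
    (hnd _ (by lia) (by lia)) (hnd _ (by lia) (by lia))
  rw [h4, h13, binomTransform] at h
  have hp0 : ((p - 1 : ℕ) : ZMod p) + 1 = 0 := by
    rw [← Nat.cast_succ, Nat.succ_eq_add_one, Nat.sub_add_cancel (by lia), ZMod.natCast_self]
  have h1 : ∀ k ∈ range (p - 1), (-1) ^ (k + 1) * ((p - 1).choose (k + 1) : ZMod p) *
      ((mhs y [1, 1] (k + 1) + mhs y [2] (k + 1)) * y k ^ 2) =
        y k ^ 2 * mhs y [1, 1] k + y k ^ 3 * mhs y [1] k + y k ^ 2 * mhs y [2] k + y k ^ 4 := by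
    intro k hk
    rw [neg_one_pow_mul_choose_eq_prod hy (Nat.succ_le_of_lt (mem_range.mp hk)), hp0]
    simp only [zero_mul, sub_zero, prod_const_one, mhs_succ, mhs_nil]
    ring
  rw [sum_congr rfl h1] at h
  simp only [sum_add_distrib] at h
  simp only [mhs_cons y _ _ (p - 1), mhs_nil, mul_one] at *
  rw [h31, h22, h4] at h
  simpa using h

end ZMod

/-! ### Reduction of the Apéry number to H(2) -/

section PadicInt

variable {p : ℕ} [Fact p.Prime] {x : ℕ → ℤ_[p]}

theorem PadicInt.toZMod_eq_zero_iff (z : ℤ_[p]) : PadicInt.toZMod z = 0 ↔ (p : ℤ_[p]) ∣ z := by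
  rw [← RingHom.mem_ker, PadicInt.ker_toZMod, PadicInt.maximalIdeal_eq_span_p,
    Ideal.mem_span_singleton]

theorem PadicInt.not_dvd_natCast {m : ℕ} (hm : ¬ p ∣ m) : ¬ (p : ℤ_[p]) ∣ (m : ℤ_[p]) := by
  rwa [← PadicInt.toZMod_eq_zero_iff, map_natCast, ZMod.natCast_eq_zero_iff]

theorem PadicInt.pow_dvd_of_pow_dvd_natCast_mul {m n : ℕ} (hm : ¬ p ∣ m) {z : ℤ_[p]}
    (h : (p : ℤ_[p]) ^ n ∣ m * z) : (p : ℤ_[p]) ^ n ∣ z :=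
  PadicInt.prime_p.pow_dvd_of_dvd_mul_left n (PadicInt.not_dvd_natCast hm) h

theorem toZMod_inv (hx : ∀ k < p - 1, ((k : ℤ_[p]) + 1) * x k = 1) :
    ∀ k < p - 1, ((k : ZMod p) + 1) * PadicInt.toZMod (x k) = 1 := by
  intro k hk
  simpa using congrArg PadicInt.toZMod (hx k hk)

theorem inv_add_inv_reflect (hx : ∀ k < p - 1, ((k : ℤ_[p]) + 1) * x k = 1) {k : ℕ}
    (hk : k < p - 1) : x k + x (p - 1 - 1 - k) = p * (x k * x (p - 1 - 1 - k)) := by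
  have h1 := hx (p - 1 - 1 - k) (by lia)
  have h2 : ((p - 1 - 1 - k : ℕ) : ℤ_[p]) + 1 + ((k : ℤ_[p]) + 1) = p := by
    have : (p - 1 - 1 - k) + 1 + (k + 1) = p := by lia
    exact_mod_cast congrArg (Nat.cast (R := ℤ_[p])) this
  linear_combination (-x (p - 1 - 1 - k)) * hx k hk - x k * h1 + x k * x (p - 1 - 1 - k) * h2

/-- Wolstenholme-type divisibility for odd exponents. -/
theorem sq_dvd_mhs_one_and_three (hp7 : 7 ≤ p) (hx : ∀ k < p - 1, ((k : ℤ_[p]) + 1) * x k = 1) :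
    (p : ℤ_[p]) ^ 2 ∣ mhs x [1] (p - 1) ∧ (p : ℤ_[p]) ^ 2 ∣ mhs x [3] (p - 1) := by
  have hy := toZMod_inv hx
  have hnd : ∀ a, 0 < a → a < 6 → ¬ (p - 1) ∣ a := fun a h0 h h' => by
    have := Nat.le_of_dvd h0 h'
    lia
  have hp2 : ¬ p ∣ 2 := fun h => by have := Nat.le_of_dvd (by lia) h; lia
  -- Pairing k with p - k in the doubled sum extracts one factor p; the second comes from the
  -- cofactors `g` summing to 0 mod p.
  have key : ∀ a, ∀ g : ℕ → ℤ_[p],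
      (∀ k < p - 1, x k ^ a + x (p - 1 - 1 - k) ^ a = p * g k) →
      (∑ k ∈ range (p - 1), PadicInt.toZMod (g k) = 0) →
      (p : ℤ_[p]) ^ 2 ∣ mhs x [a] (p - 1) := by
    intro a g hg hsum
    refine PadicInt.pow_dvd_of_pow_dvd_natCast_mul hp2 ?_
    have h2 : ((2 : ℕ) : ℤ_[p]) * mhs x [a] (p - 1) = p * ∑ k ∈ range (p - 1), g k := by
      rw [mul_sum, ← sum_congr rfl fun k hk => hg k (mem_range.mp hk), sum_add_distrib,
        Finset.sum_range_reflect (fun k => x k ^ a)]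
      simp only [mhs, mul_one]
      push_cast
      ring
    rw [h2, sq]
    refine mul_dvd_mul_left _ ?_
    rwa [← PadicInt.toZMod_eq_zero_iff, map_sum]
  constructor
  · refine key 1 (fun k => x k * x (p - 1 - 1 - k)) (fun k hk => ?_) ?_
    · simpa using inv_add_inv_reflect hx hk
    · have h := sum_inv_pow_eq_zero hy (hnd 2 (by lia) (by lia))
      simp only [mhs, mul_one] at h
      rw [← neg_eq_zero, ← sum_neg_distrib, ← h]
      refine sum_congr rfl fun k hk => ?_
      rw [map_mul, inv_reflect hy (mem_range.mp hk)]
      ring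
  · refine key 3 (fun k => x k * x (p - 1 - 1 - k) *
      (x k ^ 2 - x k * x (p - 1 - 1 - k) + x (p - 1 - 1 - k) ^ 2)) (fun k hk => ?_) ?_
    · linear_combination (x k ^ 2 - x k * x (p - 1 - 1 - k) + x (p - 1 - 1 - k) ^ 2) *
        inv_add_inv_reflect hx hk
    · have h := sum_inv_pow_eq_zero hy (hnd 4 (by lia) (by lia))
      simp only [mhs, mul_one] at h
      have h0 : (-3 : ZMod p) * ∑ k ∈ range (p - 1), PadicInt.toZMod (x k) ^ 4 = 0 := by
        rw [h, mul_zero]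
      rw [← h0, mul_sum]
      refine sum_congr rfl fun k hk => ?_
      simp only [map_mul, map_add, map_sub, map_pow, inv_reflect hy (mem_range.mp hk)]
      ring

/-- The Apéry number `A'_{p-1}` is determined modulo `p ^ 5` by `∑ 1 / k ^ 2`. -/
theorem pow_five_dvd_two_mul_aperyTwo_sub (hp7 : 7 ≤ p)
    (hx : ∀ k < p - 1, ((k : ℤ_[p]) + 1) * x k = 1) :
    (p : ℤ_[p]) ^ 5 ∣ 2 * ((aperyTwo (p - 1) : ℤ_[p]) - 1) - 5 * p ^ 2 * mhs x [2] (p - 1) := by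
  have hy := toZMod_inv hx
  have hnd : ∀ a, 0 < a → a < 6 → ¬ (p - 1) ∣ a := fun a h0 h h' => by
    have := Nat.le_of_dvd h0 h'
    lia
  have hdvd : ∀ s, mhs (fun k => PadicInt.toZMod (x k)) s (p - 1) = 0 →
      (p : ℤ_[p]) ∣ mhs x s (p - 1) := fun s hs => by
    rwa [← PadicInt.toZMod_eq_zero_iff, map_mhs]
  have hp : (p : ℤ_[p]) = ((p - 1 : ℕ) : ℤ_[p]) + 1 := by
    exact_mod_cast congrArg (Nat.cast (R := ℤ_[p])) (show p = p - 1 + 1 by lia)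
  have hpodd : Even (p - 1) := (Fact.out : p.Prime).even_sub_one (by lia)
  obtain ⟨u, hu⟩ := pow_five_dvd_aperyTwo_sub hx hpodd hp
  obtain ⟨v, hv⟩ := pow_three_dvd_inv_sq_relation hx hp
  obtain ⟨⟨s1, h1⟩, ⟨s3, h3⟩⟩ := sq_dvd_mhs_one_and_three hp7 hx
  obtain ⟨s31, h31⟩ := hdvd _ (mhs_pair_eq_zero (a := 3) (b := 1) (by lia) hy (by decide)
    (hnd _ (by lia) (by lia)) (hnd _ (by lia) (by lia)))
  obtain ⟨s22, h22⟩ := hdvd _ (mhs_pair_eq_zero (a := 2) (b := 2) (by lia) hy (by decide)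
    (hnd _ (by lia) (by lia)) (hnd _ (by lia) (by lia)))
  obtain ⟨s211, h211⟩ := hdvd _ (mhs_two_one_one_eq_zero hp7 hy)
  have hsq := mhs_mul_mhs x 1 1 (p - 1)
  norm_num at hsq
  rw [h1] at hsq
  rw [h3, h31, h211] at hv
  rw [h3, h31, h22, h211] at hu
  refine ⟨2 * u - 4 * s3 + 4 * s211 - 2 * s22 - 2 * v + p * s1 ^ 2, ?_⟩
  -- `hv` eliminates H(2,1), and `hsq` replaces 2 H(1,1) by H(1)² - H(2), with p⁴ dividing H(1)².
  -- The coefficient of H(2) becomes 2 + 4 - 1 = 5.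
  linear_combination 2 * hu - 2 * (p : ℤ_[p]) ^ 2 * hv - (p : ℤ_[p]) ^ 2 * hsq

end PadicInt

/-! ### A Voronoi congruence modulo p³ -/

theorem pow_three_dvd_two_mul_add_pow_sub {R : Type*} [CommRing R] (b d : R) (j : ℕ) :
    d ^ 3 ∣ 2 * (b + d) ^ (j + 2) - (2 * b ^ (j + 2) + 2 * ((j : R) + 2) * b ^ (j + 1) * d +
      ((j : R) + 2) * ((j : R) + 1) * b ^ j * d ^ 2) := by
  induction j with
  | zero => exact ⟨0, by push_cast; ring⟩
  | succ j ih =>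
    obtain ⟨c, hc⟩ := ih
    refine ⟨c * (b + d) + ((j : R) + 2) * ((j : R) + 1) * b ^ j, ?_⟩
    push_cast
    linear_combination (b + d) * hc

theorem sum_range_mul_mod {M : Type*} [AddCommMonoid M] {p a : ℕ} (hp : 0 < p)
    (ha : p.Coprime a) (g : ℕ → M) : ∑ k ∈ range p, g (k * a % p) = ∑ k ∈ range p, g k := by
  have hmaps : Set.MapsTo (fun k => k * a % p) (range p : Set ℕ) (range p : Set ℕ) :=
    fun k _ => by simpa using Nat.mod_lt _ hp
  have hinj : Set.InjOn (fun k => k * a % p) (range p : Set ℕ) := by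
    intro k hk l hl h
    have h1 : k ≡ l [MOD p] := Nat.ModEq.cancel_right_of_coprime ha h
    exact Nat.ModEq.eq_of_lt_of_lt h1 (by simpa using hk) (by simpa using hl)
  exact Finset.sum_nbij (fun k => k * a % p) hmaps hinj
    (Finset.surjOn_of_injOn_of_card_le _ hmaps hinj le_rfl) fun _ _ => rfl

/-- Multiplication by a permutes the residues, and ka mod p = ka - p⌊ka/p⌋ is raised to the power j
+ 2 up to p². Doubling avoids the division by 2 in C(j+2,2). -/
theorem pow_three_dvd_voronoi {R : Type*} [CommRing R] {p a : ℕ} (hp : 0 < p) (ha : p.Coprime a)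
    (j : ℕ) :
    (p : R) ^ 3 ∣ 2 * ((a : R) ^ (j + 2) - 1) * ∑ k ∈ range p, (k : R) ^ (j + 2) -
      (2 * ((j : R) + 2) * p * ∑ k ∈ range p, ((k * a / p : ℕ) : R) * ((k : R) * a) ^ (j + 1) -
        ((j : R) + 2) * ((j : R) + 1) * p ^ 2 *
          ∑ k ∈ range p, ((k * a / p : ℕ) : R) ^ 2 * ((k : R) * a) ^ j) := by
  have h := sum_range_mul_mod hp ha (fun k => (k : R) ^ (j + 2))
  have h1 : 2 * ((a : R) ^ (j + 2) - 1) * ∑ k ∈ range p, (k : R) ^ (j + 2) =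
      ∑ k ∈ range p, (2 * ((k : R) * a) ^ (j + 2) - 2 * ((k * a % p : ℕ) : R) ^ (j + 2)) := by
    rw [sum_sub_distrib, ← mul_sum, ← mul_sum, h]
    simp only [mul_pow, ← sum_mul]
    ring
  rw [h1]
  simp only [mul_sum, ← sum_sub_distrib]
  refine dvd_sum fun k _ => ?_
  have h2 : ((k * a % p : ℕ) : R) = (k : R) * a + (-(p * ((k * a / p : ℕ) : R))) := by
    have := congrArg (Nat.cast (R := R)) (Nat.mod_add_div (k * a) p)
    push_cast at this ⊢
    linear_combination this
  obtain ⟨c, hc⟩ := pow_three_dvd_two_mul_add_pow_sub ((k : R) * a)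
    (-(p * ((k * a / p : ℕ) : R))) j
  rw [h2]
  refine ⟨((k * a / p : ℕ) : R) ^ 3 * c, ?_⟩
  linear_combination -hc

/-! ### Comparison of power sums of different exponents -/

section PadicInt

variable {p : ℕ} [Fact p.Prime] {x : ℕ → ℤ_[p]}

theorem PadicInt.dvd_pow_sub_one {b : ℤ_[p]} (hb : ¬ (p : ℤ_[p]) ∣ b) :
    (p : ℤ_[p]) ∣ b ^ (p - 1) - 1 := by
  rw [← PadicInt.toZMod_eq_zero_iff, map_sub, map_pow, map_one,
    ZMod.pow_card_sub_one_eq_one (by rwa [Ne, PadicInt.toZMod_eq_zero_iff]), sub_self]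

theorem PadicInt.pow_three_dvd_pow_sub_one {b : ℤ_[p]} (hb : ¬ (p : ℤ_[p]) ∣ b) :
    (p : ℤ_[p]) ^ 3 ∣ b ^ ((p - 1) * p ^ 2) - 1 := by
  have := dvd_sub_pow_of_dvd_sub (PadicInt.dvd_pow_sub_one hb) 2
  rwa [one_pow, ← pow_mul] at this

theorem PadicInt.not_dvd_pow {b : ℤ_[p]} (hb : ¬ (p : ℤ_[p]) ∣ b) (n : ℕ) :
    ¬ (p : ℤ_[p]) ∣ b ^ n := fun h => hb (PadicInt.prime_p.dvd_of_dvd_pow h)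

/-- Second-order Fermat quotient relation between powers of `b`. -/
theorem sq_dvd_pow_second_difference (hp7 : 7 ≤ p) {b : ℤ_[p]}
    (hb : b = 0 ∨ ¬ (p : ℤ_[p]) ∣ b) {j : ℕ} (hj : j + 4 = (p - 1) * p ^ 2) :
    (p : ℤ_[p]) ^ 2 ∣ b ^ (j + 1) - 2 * b ^ (p - 5 + 1) + b ^ (2 * p - 6 + 1) := by
  rcases hb with rfl | hb
  · simp
  -- After multiplication by b³ the expression is (b^(p-1) - 1)² up to a multiple of p³.
  · refine PadicInt.prime_p.pow_dvd_of_dvd_mul_left 2 (PadicInt.not_dvd_pow hb 3) ?_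
    obtain ⟨c, hc⟩ := PadicInt.dvd_pow_sub_one hb
    obtain ⟨d, hd⟩ := PadicInt.pow_three_dvd_pow_sub_one hb
    have e0 : b ^ (j + 1) * b ^ 3 = b ^ ((p - 1) * p ^ 2) := by rw [← pow_add, ← hj]
    have e1 : b ^ (p - 5 + 1) * b ^ 3 = b ^ (p - 1) := by
      rw [← pow_add]; congr 1; lia
    have e2 : b ^ (2 * p - 6 + 1) * b ^ 3 = b ^ (p - 1) * b ^ (p - 1) := by
      rw [← pow_add, ← pow_add]; congr 1; lia
    refine ⟨c ^ 2 + p * d, ?_⟩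
    linear_combination e0 - 2 * e1 + e2 + hd + (b ^ (p - 1) - 1 + p * c) * hc

theorem dvd_pow_sub_pow {b : ℤ_[p]} (hb : b = 0 ∨ ¬ (p : ℤ_[p]) ∣ b) {i j r : ℕ}
    (hi : 0 < i) (hij : j = i + (p - 1) * r) : (p : ℤ_[p]) ∣ b ^ j - b ^ i := by
  rcases hb with rfl | hb
  · rw [zero_pow (by lia), zero_pow (by lia), sub_self]
    exact dvd_zero _
  · have h : b ^ j - b ^ i = b ^ i * ((b ^ (p - 1)) ^ r - 1) := by
      rw [hij, pow_add, pow_mul]; ring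
    rw [h]
    exact dvd_mul_of_dvd_right ((PadicInt.dvd_pow_sub_one hb).trans (sub_one_dvd_pow_sub_one _ _)) _

theorem mhs_two_sub_sum_pow (hp7 : 7 ≤ p) (hx : ∀ k < p - 1, ((k : ℤ_[p]) + 1) * x k = 1) {m : ℕ}
    (hm : m + 2 = (p - 1) * p ^ 2) (hm0 : 0 < m) :
    (p : ℤ_[p]) ^ 3 ∣ mhs x [2] (p - 1) - ∑ k ∈ range p, (k : ℤ_[p]) ^ m := by
  rw [show range p = range (p - 1 + 1) by rw [Nat.sub_add_cancel (by lia)], sum_range_succ',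
    Nat.cast_zero, zero_pow hm0.ne', add_zero]
  simp only [mhs, mul_one, ← sum_sub_distrib]
  refine dvd_sum fun k hk => ?_
  have hk' := mem_range.mp hk
  have hnd : ¬ (p : ℤ_[p]) ∣ ((k + 1 : ℕ) : ℤ_[p]) :=
    PadicInt.not_dvd_natCast fun h => by have := Nat.le_of_dvd (by lia) h; lia
  obtain ⟨c, hc⟩ := PadicInt.pow_three_dvd_pow_sub_one hnd
  rw [← hm, pow_add] at hc
  refine ⟨-c * x k ^ 2, ?_⟩
  have h := hx k hk'
  push_cast at hc ⊢
  have h2 : ((k : ℤ_[p]) + 1) ^ 2 * x k ^ 2 = 1 := by rw [← mul_pow, h, one_pow]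
  linear_combination (-x k ^ 2) * hc + ((k : ℤ_[p]) + 1) ^ m * h2

/-- The power sums `∑ k ^ (-2)`, `∑ k ^ (p - 3)` and `∑ k ^ (2 p - 4)` are related. -/
theorem power_sum_relations (hp7 : 7 ≤ p) (hx : ∀ k < p - 1, ((k : ℤ_[p]) + 1) * x k = 1) :
    (p : ℤ_[p]) ^ 3 ∣ 36 * mhs x [2] (p - 1) -
        (48 + 16 * p) * ∑ k ∈ range p, (k : ℤ_[p]) ^ (p - 3) +
        (18 + 9 * p) * ∑ k ∈ range p, (k : ℤ_[p]) ^ (2 * p - 4) ∧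
      (p : ℤ_[p]) ^ 2 ∣ 4 * ∑ k ∈ range p, (k : ℤ_[p]) ^ (p - 3) -
        3 * ∑ k ∈ range p, (k : ℤ_[p]) ^ (2 * p - 4) := by
  obtain ⟨j, hj⟩ : ∃ j, j + 4 = (p - 1) * p ^ 2 := by
    have : 4 ≤ (p - 1) * p ^ 2 := by nlinarith [Nat.sub_add_cancel (show 1 ≤ p by lia)]
    exact ⟨_, Nat.sub_add_cancel this⟩
  have hpp : p.Prime := Fact.out
  have hp2 : ¬ p ∣ 2 := fun h => by have := Nat.le_of_dvd (by lia) h; lia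
  -- The multiplier A = 2^(p²) satisfies A^(p-1) ≡ 1 mod p³. Multiplying Voronoi by A² thus gives
  -- the same factor -2(A² - 1) for all three exponents, a unit since A ≡ 2 mod p.
  have hcop : p.Coprime (2 ^ p ^ 2) :=
    ((hpp.coprime_iff_not_dvd).mpr hp2).pow_right _
  have hb : ∀ k ∈ range p, (k : ℤ_[p]) * (2 ^ p ^ 2 : ℕ) = 0 ∨
      ¬ (p : ℤ_[p]) ∣ (k : ℤ_[p]) * (2 ^ p ^ 2 : ℕ) := by
    intro k hk
    rcases Nat.eq_zero_or_pos k with rfl | hk0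
    · left; simp
    · right
      rw [← Nat.cast_mul]
      refine PadicInt.not_dvd_natCast fun h => ?_
      have := Nat.le_of_dvd hk0 (hcop.dvd_of_dvd_mul_right h)
      have := mem_range.mp hk
      lia
  have h2 : ¬ (p : ℤ_[p]) ∣ 2 := by exact_mod_cast PadicInt.not_dvd_natCast hp2
  have hA : (p : ℤ_[p]) ^ 3 ∣ ((2 ^ p ^ 2 : ℕ) : ℤ_[p]) ^ (p - 1) - 1 := by
    have := PadicInt.pow_three_dvd_pow_sub_one h2
    push_cast
    rwa [← pow_mul, mul_comm]
  have hc : ¬ (p : ℤ_[p]) ∣ -2 * (((2 ^ p ^ 2 : ℕ) : ℤ_[p]) ^ 2 - 1) := by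
    rw [← PadicInt.toZMod_eq_zero_iff]
    have h4 : ((2 ^ p ^ 2 : ℕ) : ZMod p) = 2 := by
      push_cast
      rw [sq, pow_mul, ZMod.pow_card, ZMod.pow_card]
    rw [map_mul, map_sub, map_pow, map_natCast, h4]
    have h6 : ((6 : ℕ) : ZMod p) ≠ 0 := by
      rw [Ne, ZMod.natCast_eq_zero_iff]
      intro h
      have := Nat.le_of_dvd (by lia) h
      lia
    intro h
    apply h6
    push_cast
    simp only [map_neg, map_ofNat, map_one] at h
    linear_combination -h
  have hv : ∀ i r : ℕ, i + 4 = (p - 1) * r → ∃ e : ℤ_[p],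
      -2 * (((2 ^ p ^ 2 : ℕ) : ℤ_[p]) ^ 2 - 1) * ∑ k ∈ range p, (k : ℤ_[p]) ^ (i + 2) =
      2 * ((i : ℤ_[p]) + 2) * p * (((2 ^ p ^ 2 : ℕ) : ℤ_[p]) ^ 2 * ∑ k ∈ range p,
          ((k * 2 ^ p ^ 2 / p : ℕ) : ℤ_[p]) * ((k : ℤ_[p]) * (2 ^ p ^ 2 : ℕ)) ^ (i + 1)) -
        ((i : ℤ_[p]) + 2) * ((i : ℤ_[p]) + 1) * p ^ 2 * (((2 ^ p ^ 2 : ℕ) : ℤ_[p]) ^ 2 *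
          ∑ k ∈ range p, ((k * 2 ^ p ^ 2 / p : ℕ) : ℤ_[p]) ^ 2 *
            ((k : ℤ_[p]) * (2 ^ p ^ 2 : ℕ)) ^ i) + p ^ 3 * e := by
    intro i r hir
    obtain ⟨c, hc⟩ := pow_three_dvd_voronoi (R := ℤ_[p]) hpp.pos hcop i
    obtain ⟨d, hd⟩ := hA.trans (sub_one_dvd_pow_sub_one _ r)
    rw [← pow_mul, ← hir, show i + 4 = (i + 2) + 2 by ring, pow_add] at hd
    generalize ((2 ^ p ^ 2 : ℕ) : ℤ_[p]) = A at *
    refine ⟨A ^ 2 * c - 2 * d * ∑ k ∈ range p, (k : ℤ_[p]) ^ (i + 2), ?_⟩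
    linear_combination A ^ 2 * hc - 2 * (∑ k ∈ range p, (k : ℤ_[p]) ^ (i + 2)) * hd
  obtain ⟨e0, he0⟩ := hv j (p ^ 2) hj
  obtain ⟨e1, he1⟩ := hv (p - 5) 1 (by lia)
  obtain ⟨e2, he2⟩ := hv (2 * p - 6) 2 (by lia)
  obtain ⟨s, hs⟩ := mhs_two_sub_sum_pow hp7 hx (m := j + 2) hj (by lia)
  have hj0 : (j : ℤ_[p]) = (p - 1) * p ^ 2 - 4 := by
    have := congrArg (Nat.cast (R := ℤ_[p])) hj
    push_cast [Nat.cast_sub (show 1 ≤ p by lia)] at this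
    linear_combination this
  have hj1 : ((p - 5 : ℕ) : ℤ_[p]) = p - 5 := by
    push_cast [Nat.cast_sub (show 5 ≤ p by lia)]; ring
  have hj2 : ((2 * p - 6 : ℕ) : ℤ_[p]) = 2 * p - 6 := by
    push_cast [Nat.cast_sub (show 6 ≤ 2 * p by lia)]; ring
  rw [hj0] at he0
  rw [hj1, show p - 5 + 2 = p - 3 by lia] at he1
  rw [hj2, show 2 * p - 6 + 2 = 2 * p - 4 by lia] at he2
  generalize ((2 ^ p ^ 2 : ℕ) : ℤ_[p]) = A at *
  set f : ℕ → ℤ_[p] := fun k => ((k * 2 ^ p ^ 2 / p : ℕ) : ℤ_[p]) with hf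
  set X : ℕ → ℤ_[p] := fun i => A ^ 2 * ∑ k ∈ range p, f k * ((k : ℤ_[p]) * A) ^ (i + 1) with hX
  set Y : ℕ → ℤ_[p] := fun i => A ^ 2 * ∑ k ∈ range p, f k ^ 2 * ((k : ℤ_[p]) * A) ^ i with hY
  obtain ⟨ξ, hξ⟩ : (p : ℤ_[p]) ^ 2 ∣ X j - 2 * X (p - 5) + X (2 * p - 6) := by
    have : X j - 2 * X (p - 5) + X (2 * p - 6) = A ^ 2 * ∑ k ∈ range p, f k *
        (((k : ℤ_[p]) * A) ^ (j + 1) - 2 * ((k : ℤ_[p]) * A) ^ (p - 5 + 1) +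
          ((k : ℤ_[p]) * A) ^ (2 * p - 6 + 1)) := by
      simp only [hX, mul_add, mul_sub, sum_add_distrib, sum_sub_distrib,
        mul_left_comm _ (2 : ℤ_[p]), ← mul_sum]
    rw [this]
    exact dvd_mul_of_dvd_right (dvd_sum fun k hk => dvd_mul_of_dvd_right
      (sq_dvd_pow_second_difference hp7 (hb k hk) hj) _) _
  obtain ⟨ζ, hζ⟩ : (p : ℤ_[p]) ∣ X (2 * p - 6) - X (p - 5) := by
    simp only [hX, ← mul_sub, ← sum_sub_distrib]
    exact dvd_mul_of_dvd_right (dvd_sum fun k hk => dvd_mul_of_dvd_right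
      (dvd_pow_sub_pow (hb k hk) (r := 1) (by lia) (by lia)) _) _
  obtain ⟨η, hη⟩ : (p : ℤ_[p]) ∣ Y j - Y (p - 5) := by
    simp only [hY, ← mul_sub, ← sum_sub_distrib]
    refine dvd_mul_of_dvd_right (dvd_sum fun k hk => dvd_mul_of_dvd_right
      (dvd_pow_sub_pow (hb k hk) (r := p ^ 2 - 1) (by lia) ?_) _) _
    rw [Nat.mul_sub, mul_one, ← hj]
    have : p - 1 ≤ j + 4 := by rw [hj]; exact Nat.le_mul_of_pos_right _ (by positivity)
    lia
  obtain ⟨θ, hθ⟩ : (p : ℤ_[p]) ∣ Y (2 * p - 6) - Y (p - 5) := by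
    simp only [hY, ← mul_sub, ← sum_sub_distrib]
    exact dvd_mul_of_dvd_right (dvd_sum fun k hk => dvd_mul_of_dvd_right
      (dvd_pow_sub_pow (hb k hk) (r := 1) (by lia) (by lia)) _) _
  change _ = _ * X j - _ * Y j + _ at he0
  change _ = _ * X (p - 5) - _ * Y (p - 5) + _ at he1
  change _ = _ * X (2 * p - 6) - _ * Y (2 * p - 6) + _ at he2
  generalize X j = X0 at *
  generalize X (p - 5) = X1 at *
  generalize X (2 * p - 6) = X2 at *
  generalize Y j = Y0 at *
  generalize Y (p - 5) = Y1 at *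
  generalize Y (2 * p - 6) = Y2 at *
  generalize ∑ k ∈ range p, (k : ℤ_[p]) ^ (j + 2) = T0 at *
  generalize ∑ k ∈ range p, (k : ℤ_[p]) ^ (p - 3) = T1 at *
  generalize ∑ k ∈ range p, (k : ℤ_[p]) ^ (2 * p - 4) = T2 at *
  generalize mhs x [2] (p - 1) = S at *
  constructor
  -- The weights 36, -(48 + 16p), 18 + 9p, times -2, p - 3, 2p - 4, are -72(1, -2, 1) mod p², so the
  -- X terms form the second difference in `hξ`. The Y terms cancel mod p because 36·6 - 48·12 +
  -- 18·20 = 0.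
  · refine PadicInt.prime_p.pow_dvd_of_dvd_mul_left 3 hc ⟨36 * (2 * ((p : ℤ_[p]) - 1) * X0 - 4 * ξ -
      6 * η + (5 - p ^ 2 * (p - 1)) * p * (p - 1) * Y0 + e0) - 32 * X1 +
      Y1 * (-144 - 64 * p + 16 * p ^ 2) - (48 + 16 * p) * e1 + 36 * X2 - 360 * θ -
      Y2 * (-144 - 90 * p + 36 * p ^ 2) + (18 + 9 * p) * e2 + 36 * (-2 * (A ^ 2 - 1)) * s, ?_⟩
    linear_combination 36 * he0 - (48 + 16 * (p : ℤ_[p])) * he1 + (18 + 9 * (p : ℤ_[p])) * he2 +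
      36 * (-2 * (A ^ 2 - 1)) * hs - 144 * (p : ℤ_[p]) * hξ - 216 * (p : ℤ_[p]) ^ 2 * hη -
      360 * (p : ℤ_[p]) ^ 2 * hθ
  · refine PadicInt.prime_p.pow_dvd_of_dvd_mul_left 2 hc ⟨8 * X1 - 12 * X2 + 24 * ζ -
      4 * ((p : ℤ_[p]) - 3) * (p - 4) * Y1 + 3 * (2 * p - 4) * (2 * p - 5) * Y2 +
      p * (4 * e1 - 3 * e2), ?_⟩
    linear_combination 4 * he1 - 3 * he2 + 24 * (p : ℤ_[p]) * hζ

end PadicInt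

/-! ### p-integrality of Bernoulli numbers and Faulhaber's formula -/

section PIntegers

variable (p : ℕ) [Fact p.Prime]

/-- The subring of `p`-integral rational numbers. -/
noncomputable def pIntegers : Subring ℚ := (PadicInt.subring p).comap (Rat.castHom ℚ_[p])

variable {p}

theorem mem_pIntegers_iff {q : ℚ} : q ∈ pIntegers p ↔ ‖(q : ℚ_[p])‖ ≤ 1 := Iff.rfl

theorem not_dvd_den_of_mem_pIntegers {q : ℚ} (hq : q ∈ pIntegers p) : ¬ p ∣ q.den := fun h => by
  have h1 : ¬ IsUnit (q.den : ℤ_[p]) := by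
    rw [PadicInt.isUnit_iff]
    exact ((PadicInt.norm_natCast_lt_one_iff).mpr h).ne
  exact h1 (PadicInt.isUnit_den q hq)

theorem inv_natCast_mem_pIntegers {n : ℕ} (hn : ¬ p ∣ n) : (n : ℚ)⁻¹ ∈ pIntegers p := by
  have h : ‖(n : ℚ_[p])‖ = 1 :=
    Padic.norm_natCast_eq_one_iff.mpr (((Fact.out : p.Prime).coprime_iff_not_dvd).mpr hn)
  rw [mem_pIntegers_iff]
  push_cast
  rw [norm_inv, h, inv_one]

theorem bernoulli_even_eq (k : ℕ) : ∃ z : ℤ, bernoulli (2 * k) =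
    z - ∑ q ∈ range (2 * k + 2) with q.Prime ∧ (q - 1) ∣ 2 * k, (1 : ℚ) / q := by
  obtain ⟨z, hz⟩ := Bernoulli.vonStaudt_clausen k
  exact ⟨z, by rw [hz]; ring⟩

theorem bernoulli_mem_pIntegers {n : ℕ} (hn : Even n) (hd : ¬ (p - 1) ∣ n) :
    bernoulli n ∈ pIntegers p := by
  obtain ⟨k, rfl⟩ := hn.two_dvd
  obtain ⟨z, hz⟩ := bernoulli_even_eq k
  rw [hz]
  refine sub_mem (intCast_mem _ z) (sum_mem fun q hq => ?_)
  obtain ⟨-, hqp, hqd⟩ := mem_filter.mp hq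
  rw [one_div]
  refine inv_natCast_mem_pIntegers fun h => hd ?_
  rwa [(Nat.prime_dvd_prime_iff_eq Fact.out hqp).mp h]

theorem mul_bernoulli_mem_pIntegers (hp2 : p ≠ 2) (n : ℕ) :
    (p : ℚ) * bernoulli n ∈ pIntegers p := by
  rcases Nat.even_or_odd n with hn | hn
  · obtain ⟨k, rfl⟩ := hn.two_dvd
    obtain ⟨z, hz⟩ := bernoulli_even_eq k
    rw [hz, mul_sub, mul_sum]
    refine sub_mem (mul_mem (natCast_mem _ p) (intCast_mem _ z)) (sum_mem fun q hq => ?_)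
    obtain ⟨-, hqp, -⟩ := mem_filter.mp hq
    rw [one_div]
    by_cases h : p = q
    · rw [← h, mul_inv_cancel₀ (Nat.cast_ne_zero.mpr (Fact.out : p.Prime).ne_zero)]
      exact one_mem _
    · exact mul_mem (natCast_mem _ p) (inv_natCast_mem_pIntegers fun h' =>
        h ((Nat.prime_dvd_prime_iff_eq Fact.out hqp).mp h'))
  · rcases eq_or_ne n 1 with rfl | h1
    · rw [bernoulli_one, neg_div, one_div]
      exact mul_mem (natCast_mem _ p) (neg_mem (inv_natCast_mem_pIntegers (n := 2) fun h =>
        hp2 ((Nat.prime_dvd_prime_iff_eq Fact.out Nat.prime_two).mp h)))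
    · rw [bernoulli_eq_zero_of_odd hn (by have := hn.pos; lia), mul_zero]
      exact zero_mem _

/-- If p^e exactly divides s + 1 with e ≥ 1, then 4e + 1 ≤ p^e ≤ s + 1, which gives e ≤ s - 3. -/
theorem pow_div_succ_mem_pIntegers (hp5 : 5 ≤ p) {s : ℕ} (hs : 3 ≤ s) :
    (p : ℚ) ^ (s - 3) / ((s + 1 : ℕ) : ℚ) ∈ pIntegers p := by
  obtain ⟨e, u, hu, hsu⟩ := Nat.exists_eq_pow_mul_and_not_dvd (show s + 1 ≠ 0 by lia) p
    (Fact.out : p.Prime).ne_one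
  have hp0 : (p : ℚ) ≠ 0 := Nat.cast_ne_zero.mpr (Fact.out : p.Prime).ne_zero
  have he : e ≤ s - 3 := by
    rcases Nat.eq_zero_or_pos e with rfl | he
    · exact Nat.zero_le _
    · have h1 : ∀ e : ℕ, 4 * e + 1 ≤ p ^ e := by
        intro e
        induction e with
        | zero => simp
        | succ e ih => rw [pow_succ]; nlinarith
      have h2 : p ^ e ≤ s + 1 := by
        rw [hsu]
        exact Nat.le_mul_of_pos_right _ (Nat.pos_of_ne_zero fun h => hu (h ▸ dvd_zero p))
      have := h1 e
      lia
  have : (p : ℚ) ^ (s - 3) / ((s + 1 : ℕ) : ℚ) = (p : ℚ) ^ (s - 3 - e) * (u : ℚ)⁻¹ := by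
    rw [hsu, show s - 3 = s - 3 - e + e by lia, pow_add]
    push_cast
    rw [show s - 3 - e + e - e = s - 3 - e by lia]
    field_simp
  rw [this]
  exact mul_mem (pow_mem (natCast_mem _ p) _) (inv_natCast_mem_pIntegers hu)

/-- Power sums of even exponent modulo `p ^ 3`. -/
theorem sum_range_pow_eq_mul_bernoulli_add (hp5 : 5 ≤ p) {n : ℕ} (hn : Even n) (hn0 : 0 < n)
    (hd : ¬ (p - 1) ∣ n) : ∃ z ∈ pIntegers p,
      ∑ k ∈ range p, (k : ℚ) ^ (n + 2) = p * bernoulli (n + 2) + p ^ 3 * z := by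
  -- In Faulhaber's formula i = n + 2 is the main term and i = n + 1 vanishes. At i = n the number
  -- B_n is itself p-integral; for smaller i one power of p clears the denominator of B_i.
  have hterm : ∀ i ∈ range (n + 1), ∃ z ∈ pIntegers p,
      bernoulli i * ((n + 2 + 1).choose i) * (p : ℚ) ^ (n + 2 + 1 - i) / ((n + 2 : ℕ) + 1) =
        p ^ 3 * z := by
    intro i hi
    have hi' := mem_range.mp hi
    obtain ⟨s, hs⟩ := Nat.exists_eq_add_of_le (show i + 2 ≤ n + 2 by lia)
    have hc : ((n + 2).choose i : ℚ) * ((n + 2 : ℕ) + 1) =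
        (n + 2 + 1).choose i * ((s + 2 : ℕ) + 1) := by
      have := Nat.choose_mul_succ_eq (n + 2) i
      rw [show n + 2 + 1 - i = s + 2 + 1 by lia] at this
      exact_mod_cast this
    have e1 : bernoulli i * ((n + 2 + 1).choose i) * (p : ℚ) ^ (n + 2 + 1 - i) /
        ((n + 2 : ℕ) + 1) = p ^ 3 * (bernoulli i * (n + 2).choose i *
          (p ^ s / ((s + 2 : ℕ) + 1))) := by
      rw [show n + 2 + 1 - i = s + 3 by lia]
      have h1 : ((n + 2 : ℕ) : ℚ) + 1 ≠ 0 := by positivity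
      have h2 : ((s + 2 : ℕ) : ℚ) + 1 ≠ 0 := by positivity
      field_simp
      linear_combination (-(bernoulli i * (p : ℚ) ^ (s + 3))) * hc
    refine ⟨_, ?_, e1⟩
    rcases Nat.eq_zero_or_pos s with rfl | hs0
    · have : i = n := by lia
      subst this
      refine mul_mem (mul_mem (bernoulli_mem_pIntegers hn hd) (natCast_mem _ _)) ?_
      have h3 : ¬ p ∣ 3 := fun h => by have := Nat.le_of_dvd (by lia) h; lia
      have := inv_natCast_mem_pIntegers h3
      norm_num at this ⊢
      exact this
    · have h := pow_div_succ_mem_pIntegers hp5 (s := s + 2) (by lia)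
      have e2 : bernoulli i * (n + 2).choose i * ((p : ℚ) ^ s / ((s + 2 : ℕ) + 1)) =
          (p * bernoulli i) * (n + 2).choose i *
            ((p : ℚ) ^ (s + 2 - 3) / ((s + 2 + 1 : ℕ) : ℚ)) := by
        obtain ⟨r, rfl⟩ := Nat.exists_eq_succ_of_ne_zero hs0.ne'
        rw [show r.succ + 2 - 3 = r by lia, pow_succ]
        push_cast
        ring
      rw [e2]
      exact mul_mem (mul_mem (mul_bernoulli_mem_pIntegers (by lia) i) (natCast_mem _ _)) h
  choose! z hz hz' using hterm
  refine ⟨∑ i ∈ range (n + 1), z i, sum_mem hz, ?_⟩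
  rw [sum_range_pow, sum_range_succ, sum_range_succ, sum_congr rfl hz', ← mul_sum,
    bernoulli_eq_zero_of_odd hn.add_one (by lia), Nat.choose_succ_self_right,
    show n + 2 + 1 - (n + 2) = 1 by lia]
  have h1 : ((n + 2 : ℕ) : ℚ) + 1 ≠ 0 := by positivity
  push_cast at h1 ⊢
  field_simp
  ring

/-- Lift of a `p`-integral rational number to `ℤ_[p]`. -/
theorem exists_padicInt_of_mem_pIntegers {q : ℚ} (hq : q ∈ pIntegers p) :
    ∃ z : ℤ_[p], (z : ℚ_[p]) = q := ⟨⟨q, hq⟩, rfl⟩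

theorem exists_bernoulli_power_sum (hp5 : 5 ≤ p) {n : ℕ} (hn : Even n) (hn0 : 0 < n)
    (hd : ¬ (p - 1) ∣ n) (hd' : ¬ (p - 1) ∣ n + 2) : ∃ b z : ℤ_[p],
      (b : ℚ_[p]) = bernoulli (n + 2) ∧
        ∑ k ∈ range p, (k : ℤ_[p]) ^ (n + 2) = p * b + p ^ 3 * z := by
  obtain ⟨z, hz, h⟩ := sum_range_pow_eq_mul_bernoulli_add hp5 hn hn0 hd
  obtain ⟨b, hb⟩ := exists_padicInt_of_mem_pIntegers
    (bernoulli_mem_pIntegers (p := p) (hn.add even_two) hd')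
  obtain ⟨w, hw⟩ := exists_padicInt_of_mem_pIntegers hz
  refine ⟨b, w, hb, ?_⟩
  apply PadicInt.ext
  push_cast
  rw [hb, hw]
  have h' := congrArg (Rat.cast (K := ℚ_[p])) h
  push_cast at h'
  refine (map_sum PadicInt.Coe.ringHom _ _).trans (Eq.trans ?_ h')
  simp

theorem exists_inv_succ : ∃ x : ℕ → ℤ_[p], ∀ k < p - 1, ((k : ℤ_[p]) + 1) * x k = 1 := by
  refine ⟨fun k => PadicInt.inv (k + 1), fun k hk => ?_⟩
  refine PadicInt.mul_inv ?_
  have : ((k : ℤ_[p]) + 1) = ((k + 1 : ℕ) : ℤ_[p]) := by push_cast; rfl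
  rw [this, PadicInt.norm_natCast_eq_one_iff]
  exact ((Fact.out : p.Prime).coprime_iff_not_dvd).mpr fun h => by
    have := Nat.le_of_dvd (by lia) h
    lia

end PIntegers

/-! ### Assembly of the congruence -/

theorem theorem1p2 (p : ℕ) (hp : p.Prime) (hp7 : 7 ≤ p) :
    RatModEq (p ^ 5) (aperyTwo (p - 1) : ℚ)
      (1 + (p : ℚ) ^ 3 * (10 / 3 * bernoulli (p - 3) - 5 / 4 * bernoulli (2 * p - 4))
        + 5 / 18 * (p : ℚ) ^ 4 * bernoulli (p - 3)) := by
  have : Fact p.Prime := ⟨hp⟩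
  obtain ⟨x, hx⟩ := exists_inv_succ (p := p)
  have hodd : p % 2 = 1 := hp.eq_two_or_odd.resolve_left (by lia)
  have hnd : ∀ n, 0 < n → n < p - 1 → ¬ (p - 1) ∣ n := fun n h0 h h' => by
    have := Nat.le_of_dvd h0 h'
    lia
  have hnd' : ∀ n, p - 1 < n → n < 2 * (p - 1) → ¬ (p - 1) ∣ n := fun n h0 h h' => by
    exact hnd (n - (p - 1)) (by lia) (by lia) (Nat.dvd_sub h' dvd_rfl)
  obtain ⟨b1, z1, hb1, h1⟩ := exists_bernoulli_power_sum (p := p) (n := p - 5) (by lia)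
    (by rw [Nat.even_iff]; lia) (by lia) (hnd _ (by lia) (by lia)) (hnd _ (by lia) (by lia))
  obtain ⟨b2, z2, hb2, h2⟩ := exists_bernoulli_power_sum (p := p) (n := 2 * p - 6) (by lia)
    (by rw [Nat.even_iff]; lia) (by lia) (hnd' _ (by lia) (by lia)) (hnd' _ (by lia) (by lia))
  rw [show p - 5 + 2 = p - 3 by lia] at hb1 h1
  rw [show 2 * p - 6 + 2 = 2 * p - 4 by lia] at hb2 h2
  obtain ⟨⟨u, hu⟩, ⟨v, hv⟩⟩ := power_sum_relations hp7 hx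
  obtain ⟨w, hw⟩ := pow_five_dvd_two_mul_aperyTwo_sub hp7 hx
  rw [h1, h2] at hu hv
  have hp0 : (p : ℤ_[p]) ≠ 0 := PadicInt.prime_p.ne_zero
  -- A Kummer-type congruence, from dividing the power sum relation by p.
  have hkum : 4 * b1 - 3 * b2 = p * (v - p * (4 * z1 - 3 * z2)) :=
    mul_left_cancel₀ hp0 (by linear_combination hv)
  -- The factor 72 = 2·36 clears both earlier relations. The p⁴ coefficient 80 b1 - 45 b2 equals 20
  -- b1 + 15(4 b1 - 3 b2), which `hkum` reduces to 20 b1.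
  obtain ⟨c, hc⟩ : ∃ c : ℤ_[p], 72 * ((aperyTwo (p - 1) : ℤ_[p]) - 1) -
      p ^ 3 * (240 * b1 - 90 * b2) - 20 * p ^ 4 * b1 = p ^ 5 * c :=
    ⟨36 * w + 5 * u + 5 * (48 + 16 * p) * z1 - 5 * (18 + 9 * p) * z2 +
      15 * (v - p * (4 * z1 - 3 * z2)), by
      linear_combination 36 * hw + 5 * (p : ℤ_[p]) ^ 2 * hu + 15 * (p : ℤ_[p]) ^ 4 * hkum⟩
  have hpQ : (p : ℚ) ≠ 0 := Nat.cast_ne_zero.mpr hp.ne_zero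
  have hpQp : (p : ℚ_[p]) ≠ 0 := Nat.cast_ne_zero.mpr hp.ne_zero
  set y : ℚ := 1 + (p : ℚ) ^ 3 * (10 / 3 * bernoulli (p - 3) - 5 / 4 * bernoulli (2 * p - 4))
        + 5 / 18 * (p : ℚ) ^ 4 * bernoulli (p - 3) with hy
  refine ⟨((aperyTwo (p - 1) : ℚ) - y) / p ^ 5, ?_, ?_⟩
  · refine Nat.Coprime.pow_right 5 (((hp.coprime_iff_not_dvd).mpr
      (not_dvd_den_of_mem_pIntegers ?_)).symm)
    have hmem : 72 * (((aperyTwo (p - 1) : ℚ) - y) / p ^ 5) ∈ pIntegers p := by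
      have : ((72 * (((aperyTwo (p - 1) : ℚ) - y) / p ^ 5) : ℚ) : ℚ_[p]) = c := by
        have hcast : ∀ m : ℕ, [m.AtLeastTwo] →
            ((OfNat.ofNat m : ℤ_[p]) : ℚ_[p]) = OfNat.ofNat m :=
          fun m _ => map_ofNat PadicInt.Coe.ringHom m
        have hc' := congrArg (fun t : ℤ_[p] => (t : ℚ_[p])) hc
        push_cast at hc'
        rw [hb1, hb2, hcast 72, hcast 240, hcast 90, hcast 20] at hc'
        rw [hy]
        push_cast
        rw [← mul_div_assoc, div_eq_iff (pow_ne_zero 5 hpQp)]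
        linear_combination hc'
      rw [mem_pIntegers_iff, this]
      exact c.2
    have h72 : ¬ p ∣ 72 := fun h => by
      have h6 : p ∣ 2 ^ 3 * 3 ^ 2 := by simpa using h
      rcases (hp.dvd_mul).mp h6 with h | h
      · have := Nat.le_of_dvd (by lia) (hp.dvd_of_dvd_pow h)
        lia
      · have := Nat.le_of_dvd (by lia) (hp.dvd_of_dvd_pow h)
        lia
    have := mul_mem (inv_natCast_mem_pIntegers h72) hmem
    convert this using 1
    push_cast
    ring
  · push_cast
    field_simp
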